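/- **Setting.** Let $m\ge n$ with $n$ even, and $W\ge 1$. A *program* is a straight-line program (a finite directed acyclic graph whose vertices are words) over the entries of a real $m\times n$ matrix $A$, with operations $+,-,\times,\div$, constants and unary real functions (square root, sign, ...). It is run by a single processor with a fast memory of $W$ words and an unbounded slow memory. Initially fast memory is empty and slow memory holds $A$. The processor may send messages, each carrying a set of words from slow to fast or from fast to slow memory; execute an operation whose operands are all in fast memory (the result is placed in fast memory and may overwrite words there); and discard words from fast memory. Fast memory never holds more than $W$ words, so a message carries at most $W$ words. Write $A=QR$ ($Q^TQ=I$, $R$ upper triangular), $\bar A=A(:,\tfrac n2+1:n)$, $\bar Q=Q(:,1:\tfrac n2)$ and $\bar R=\bar Q^T\bar A$, the upper right $\frac n2\times\frac n2$ block of $R$. A program is a *columnwise QR algorithm* if * it computes the factor $R$ of a QR decomposition of every $A$ in some nonempty open set of matrices (for instance all matrices of full column rank), column $c$ of $R$ being computed from columns $1,\dots,c$ of $A$ only, and each column $\bar R_{:,k}$ from the left half of $A$ and $\bar A_{:,k}$ only; * there are data structures $\tilde Q$ (indexed by $(j,i)$) and $\tilde A$ (indexed by $(j,k)$), $1\le j\le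 m$, $1\le i,k\le \frac n2$. Each vertex belongs to at most one entry of each, and is a partial result for at most one entry of $\bar R$. The words of $\tilde Q$ (representing $\bar Q$) are computed from the left half of $A$ only. $\tilde A_{j,k}$ initially holds $\bar A_{j,k}$, and any other value stored in $\tilde A_{j,k}$ is computed directly from a value stored there before. No partial result for $\bar R_{i,k}$ is thrown away: it is $\bar R_{i,k}$ itself or an operand of a further partial result for $\bar R_{i,k}$; * say that the algorithm *multiplies at* $(i,j,k)$ if some product of a word stored in $\tilde Q_{j,i}$ and a value stored in $\tilde A_{j,k}$ is a partial result for $\bar R_{i,k}$. Then at least one of the following holds. (a) For all $i,k$ there are at least $m-i$ indices $j$ such that the algorithm multiplies at $(i,j,k)$. (b) Every intermediate result that depends on $\bar A_{:,k}$ and is used to compute $\bar R_{:,k}$ is an entry of $\bar A_{:,k}$, a sum or difference of two such results, or a product of one such result with a constant or a component of $\tilde Q$, these multipliers being independent of $\bar A_{:,k}$; each $\tilde Q_{j,i}$ is a single word; and whenever $\tilde Q_{j,i}$ is used as such a multiplier for column $k$, the algorithm multiplies at $(i,j,k)$. An execution must leave $R$ and $\tilde Q$ in slow memory at the end and must not compute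 a word of $\tilde Q$ a second time; other values may be recomputed. **Claim.** Every execution of a columnwise QR algorithm on $m\times n$ matrices moves $$\#\text{words}\;\ge\;\frac{\frac{mn^2}{4}-\frac{n^2}{8}\left(\frac n2+1\right)}{(8W)^{1/2}}-W\;\ge\;\frac{3n^2\left(m-\frac43\right)}{16(8W)^{1/2}}-W$$ words between fast and slow memory, and uses $$\#\text{messages}\;\ge\;\frac{\frac{mn^2}{4}-\frac{n^2}{8}\left(\frac n2+1\right)}{(8W^3)^{1/2}}-1\;\ge\;\frac{3n^2\left(m-\frac43\right)}{16(8W^3)^{1/2}}-1$$ messages. -/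

import Mathlib

namespace SeqQR

/-! ### Columns of the left and of the right half of a matrix with `n` columns -/

/-- The `i`-th column of the left half `A(:, 1 : n/2)`. -/
def leftCol {n : ℕ} (i : Fin (n / 2)) : Fin n := ⟨i, by have := i.2; omega⟩

/-- The `k`-th column of the right half `A(:, n/2+1 : n)`. -/
def rightCol {n : ℕ} (k : Fin (n / 2)) : Fin n := ⟨n / 2 + k, by have := k.2; omega⟩

/-! ### Straight-line programs over the reals -/

/-- One operation on values named by `V`. Square roots, reciprocals, signs (for
sign choices), copies and the like are instances of `unary`. -/
inductive Op (m n : ℕ) (V : Type) : Type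
  | input (j : Fin m) (c : Fin n)
  | const (a : ℝ)
  | unary (f : ℝ → ℝ) (x : V)
  | add (x y : V)
  | sub (x y : V)
  | mul (x y : V)
  | div (x y : V)

namespace Op

variable {m n : ℕ} {V : Type}

/-- The operands. -/
def args : Op m n V → List V
  | input _ _ => []
  | const _ => []
  | unary _ x => [x]
  | add x y => [x, y]
  | sub x y => [x, y]
  | mul x y => [x, y]
  | div x y => [x, y]

/-- The entries of the input matrix are given, not computed. -/
def IsInput (o : Op m n V) : Prop := ∃ j c, o = input j c

/-- The result, given the input matrix and the values of the operands. -/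
noncomputable def eval (A : Matrix (Fin m) (Fin n) ℝ) (x : V → ℝ) : Op m n V → ℝ
  | input j c => A j c
  | const a => a
  | unary f u => f (x u)
  | add u v => x u + x v
  | sub u v => x u - x v
  | mul u v => x u * x v
  | div u v => x u / x v

theorem eval_congr (A : Matrix (Fin m) (Fin n) ℝ) {x y : V → ℝ} (o : Op m n V)
    (h : ∀ w ∈ o.args, x w = y w) : o.eval A x = o.eval A y := by
  cases o <;> simp_all [args, eval]

end Op

/-- A directed acyclic graph of operations on the entries of an `m × n` matrix. Each vertex
is one word (the result of one operation). -/
structure Program (m n : ℕ) where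
  size : ℕ
  op : Fin size → Op m n (Fin size)
  args_lt : ∀ v, ∀ w ∈ (op v).args, w < v

namespace Program

variable {m n : ℕ} (P : Program m n)

/-- The vertices of the graph. -/
abbrev Vertex : Type := Fin P.size

/-- The value of each vertex when the program is applied to the matrix `A`. -/
noncomputable def value (A : Matrix (Fin m) (Fin n) ℝ) : P.Vertex → ℝ :=
  (wellFounded_lt (α := P.Vertex)).fix fun v rec =>
    (P.op v).eval A fun w => if h : w < v then rec w h else 0

theorem value_eq (A : Matrix (Fin m) (Fin n) ℝ) (v : P.Vertex) :
    P.value A v = (P.op v).eval A (P.value A) := by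
  unfold value
  rw [WellFounded.fix_eq]
  exact Op.eval_congr A _ fun w hw => by simp [P.args_lt v w hw]

/-- `w` is `v` or one of the vertices from which `v` is computed, directly or indirectly. -/
def Ancestor (w v : P.Vertex) : Prop :=
  Relation.ReflTransGen (fun x y => x ∈ (P.op y).args) w v

/-- The computation of `v` uses some entry of column `c` of the input matrix. -/
def DependsOn (v : P.Vertex) (c : Fin n) : Prop :=
  ∃ w j, P.op w = Op.input j c ∧ P.Ancestor w v

end Program

/-! ### A processor with a fast memory of `W` words and an unbounded slow memory -/

/-- The words that are present in fast memory and in slow memory. -/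
structure State (V : Type) where
  fast : Finset V
  slow : Finset V

/-- `read S` and `write S` are messages that carry the words in `S` from slow to fast and from
fast to slow memory. `compute v D` executes the operation at `v`; the result may overwrite words:
those in `D` leave fast memory. `discard D` frees the space taken by the words in `D`. -/
inductive Move (V : Type) : Type
  | read (S : Finset V)
  | write (S : Finset V)
  | compute (v : V) (D : Finset V)
  | discard (D : Finset V)

namespace Move

variable {V : Type}

/-- The number of words moved between fast and slow memory. -/
def words : Move V → ℕ
  | read S => S.card
  | write S => S.card
  | compute _ _ => 0
  | discard _ => 0

/-- The number of messages sent. -/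
def messages : Move V → ℕ
  | read _ => 1
  | write _ => 1
  | compute _ _ => 0
  | discard _ => 0

/-- The vertex that is computed, if any. -/
def computed : Move V → Option V
  | compute v _ => some v
  | _ => none

/-- The effect on the memories. -/
def next [DecidableEq V] (s : State V) : Move V → State V
  | read S => ⟨s.fast ∪ S, s.slow⟩
  | write S => ⟨s.fast, s.slow ∪ S⟩
  | compute v D => ⟨insert v (s.fast \ D), s.slow⟩
  | discard D => ⟨s.fast \ D, s.slow⟩

/-- Only words in slow memory can be read, only words in fast memory can be written, an operation
needs all its operands in fast memory, and fast memory never holds more than `W` words. (So no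
message carries more than `W` words.) -/
def Legal {m n : ℕ} (P : Program m n) (W : ℕ) (s : State P.Vertex) : Move P.Vertex → Prop
  | read S => S ⊆ s.slow ∧ (s.fast ∪ S).card ≤ W
  | write S => S ⊆ s.fast
  | compute v D =>
      ¬ (P.op v).IsInput ∧ (∀ w ∈ (P.op v).args, w ∈ s.fast) ∧ (insert v (s.fast \ D)).card ≤ W
  | discard _ => True

end Move

/-- The total number of words moved between fast and slow memory. -/
def wordsMoved {V : Type} (l : List (Move V)) : ℕ := (l.map Move.words).sum

/-- The total number of messages. -/
def messagesSent {V : Type} (l : List (Move V)) : ℕ := (l.map Move.messages).sum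

/-- The state after a list of moves. -/
def finalState {V : Type} [DecidableEq V] (s : State V) (l : List (Move V)) : State V :=
  l.foldl Move.next s

/-- All moves of the list are legal when they are made. -/
def LegalFrom {m n : ℕ} (P : Program m n) (W : ℕ) : State P.Vertex → List (Move P.Vertex) → Prop
  | _, [] => True
  | s, a :: l => a.Legal P W s ∧ LegalFrom P W (a.next s) l

open Classical in
/-- At the beginning fast memory is empty, and slow memory holds the input matrix. -/
noncomputable def initialState {m n : ℕ} (P : Program m n) : State P.Vertex where
  fast := ∅
  slow := Finset.univ.filter fun v => (P.op v).IsInput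

/-! ### Columnwise QR algorithms -/

/-- A columnwise algorithm for the QR decomposition of `m × n` matrices. With `Qbar` the first
`n/2` columns of `Q`, `Abar` the last `n/2` columns of `A`, and `Rbar = Qbarᵀ * Abar` the upper
right block of `R`, the graph comes with two data structures, `Qtilde` (entries `(j, i)`), which
represents `Qbar`, and `Atilde` (entries `(j, k)`), which holds `Abar` and the intermediate results
that overwrite it. Every vertex belongs to at most one entry of each, and is a partial
result for at most one entry `(i, k)` of `Rbar`. -/
structure ColumnwiseQR {m n : ℕ} (P : Program m n) where
  /-- The vertices that hold the entries of `R` on and above the diagonal. -/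
  R : Fin n → Fin n → P.Vertex
  /-- The matrices on which the program is required to work; for instance, all those of full
  column rank. -/
  dom : Set (Matrix (Fin m) (Fin n) ℝ)
  dom_open : IsOpen dom
  dom_nonempty : dom.Nonempty
  /-- `A = Q * R` with orthonormal columns in `Q` and `R` upper triangular. -/
  correct : ∀ A ∈ dom, ∃ Q : Matrix (Fin m) (Fin n) ℝ, Q.transpose * Q = 1 ∧
    A = Q * Matrix.of fun i c => if i ≤ c then P.value A (R i c) else 0
  /-- The entry of `Qtilde` in which the value of a vertex is stored, if any. -/
  locQ : P.Vertex → Option (Fin m × Fin (n / 2))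
  /-- The entry of `Atilde` in which the value of a vertex is stored, if any. -/
  locA : P.Vertex → Option (Fin m × Fin (n / 2))
  /-- The entry of `Rbar` for which a vertex is a partial result, if any. -/
  locR : P.Vertex → Option (Fin (n / 2) × Fin (n / 2))
  /-- Column `c` of `R` is computed from the columns up to `c` of `A`. -/
  columnwise_R : ∀ i c, i ≤ c → ∀ c', P.DependsOn (R i c) c' → c' ≤ c
  /-- `Qtilde` is computed from the left half of `A`. -/
  columnwise_Q : ∀ v p, locQ v = some p → ∀ c', P.DependsOn v c' → (c' : ℕ) < n / 2
  /-- The columns of `Abar` are treated independently of each other. -/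
  independent : ∀ i k c', P.DependsOn (R (leftCol i) (rightCol k)) c' →
    (c' : ℕ) < n / 2 ∨ c' = rightCol k
  /-- `Atilde` initially holds `Abar`. -/
  A_input : ∀ v j k, P.op v = Op.input j (rightCol k) → locA v = some (j, k)
  /-- Every other value stored in an entry of `Atilde` is an update of a value stored there. -/
  A_update : ∀ v j k, locA v = some (j, k) → P.op v = Op.input j (rightCol k) ∨
    ∃ w ∈ (P.op v).args, locA w = some (j, k)
  /-- No partial result for an entry of `Rbar` is thrown away: unless it is that entry itself,
  some further partial result for the same entry is computed from it. -/
  R_kept : ∀ v i k, locR v = some (i, k) → v = R (leftCol i) (rightCol k) ∨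
    ∃ w, v ∈ (P.op w).args ∧ locR w = some (i, k)

namespace ColumnwiseQR

variable {m n : ℕ} {P : Program m n} (C : ColumnwiseQR P)

/-- The multiplication at the lattice point `(i, j, k)`: some value stored in `Qtilde (j, i)` is
multiplied by some value stored in `Atilde (j, k)`, and the product is a partial result for
`Rbar (i, k)`. -/
def Multiplies (i : Fin (n / 2)) (j : Fin m) (k : Fin (n / 2)) : Prop :=
  ∃ v q a, (P.op v = Op.mul q a ∨ P.op v = Op.mul a q) ∧
    C.locQ q = some (j, i) ∧ C.locA a = some (j, k) ∧ C.locR v = some (i, k)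

/-- For all `i` and `k` there are at least `m - i` common components of column `i` of `Qtilde` and
column `k` of `Atilde` (with `i` counted from one; here `Fin (n / 2)` counts from zero). -/
def CommonComponents : Prop :=
  ∀ i k : Fin (n / 2), m - ((i : ℕ) + 1) ≤ {j | C.Multiplies i j k}.ncard

/-- `y` is a value independent of `Abar` by which the algorithm multiplies some value that
depends on column `k` of `Abar` in order to compute column `k` of `Rbar`. -/
def UsesMultiplier (k : Fin (n / 2)) (y : P.Vertex) : Prop :=
  ∃ i v x, P.Ancestor v (C.R (leftCol i) (rightCol k)) ∧
    (P.op v = Op.mul x y ∨ P.op v = Op.mul y x) ∧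
    P.DependsOn x (rightCol k) ∧ ¬ P.DependsOn y (rightCol k)

/-- Column `k` of `Rbar` is computed from column `k` of `Abar` by additions, subtractions and
multiplications by entries of `Qtilde` (or constants), all intermediate results being homogeneous
linear in column `k` of `Abar`; each entry `(j, i)` of `Qtilde` is one word, and if it is used at
all for column `k`, then it is multiplied by a value stored in `Atilde (j, k)`. Nothing is
required of the number of multiplications. -/
structure LinearInColumns : Prop where
  linear : ∀ i k v, P.Ancestor v (C.R (leftCol i) (rightCol k)) → P.DependsOn v (rightCol k) →
    (∃ j, P.op v = Op.input j (rightCol k)) ∨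
    (∃ x y, (P.op v = Op.add x y ∨ P.op v = Op.sub x y) ∧
      P.DependsOn x (rightCol k) ∧ P.DependsOn y (rightCol k)) ∨
    (∃ x y, (P.op v = Op.mul x y ∨ P.op v = Op.mul y x) ∧
      P.DependsOn x (rightCol k) ∧ ¬ P.DependsOn y (rightCol k))
  single : ∀ v w p, C.locQ v = some p → C.locQ w = some p → v = w
  multiplier : ∀ k y, C.UsesMultiplier k y → (∃ a, P.op y = Op.const a) ∨
    ∃ j i, C.locQ y = some (j, i) ∧ C.Multiplies i j k

/-- The list of moves carries out the algorithm with a fast memory of `W` words: it is legal, at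
the end `R` and `Qtilde` (the representation of `Q`) are in slow memory, and entries
of `Qtilde` are not computed a second time. (Other values may be recomputed.) -/
structure Executes (W : ℕ) (l : List (Move P.Vertex)) : Prop where
  legal : LegalFrom P W (initialState P) l
  R_stored : ∀ i c, i ≤ c → C.R i c ∈ (finalState (initialState P) l).slow
  Q_stored : ∀ v, C.locQ v ≠ none → v ∈ (finalState (initialState P) l).slow
  Q_once : ∀ v, C.locQ v ≠ none → (l.filterMap Move.computed).count v ≤ 1

end ColumnwiseQR

end SeqQR

/-!
# Communication lower bounds for columnwise QR algorithms

The bounds rest on two counts: the algorithm has to multiply at many lattice points `(i, j, k)`,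
and few of these multiplications fit between two times at which `W` words have been moved.

**Few multiplications per phase.** A multiplication at `(i, j, k)` uses a word of `Qtilde (j, i)`
and one of `Atilde (j, k)` and contributes to `Rbar (i, k)`. By the Loomis–Whitney inequality
(`card_sq_le_of_shadows`) the number of lattice points of a phase is at most the square root of the
product of the numbers of entries of the three kinds that are involved. Each such entry is
witnessed by a word in fast memory at one of the two ends of the phase or by a word moved in it.

* A value of `Atilde` is an update of a previous one, so its entry was present at the beginning of
  the phase or is read (`Executes.exists_locA`).
* A word of `Qtilde` computed in the phase cannot be computed again, so it is still present at the
  end or is written (`Executes.mem_of_locQ`).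
* Since products may be recomputed, each lattice point is assigned to one particular computation
  of its product, namely one whose result, handed on along a chain of partial results, survives
  until `Rbar (i, k)` is stored (`Executes.exists_lasting`). Its entry is therefore represented at
  the end of the phase, in fast memory or by a word written in the phase.

Altogether a phase with `W` moved words has at most `√(8 * W ^ 3)` lattice points
(`Executes.card_sq_le_of_phase`), and the execution consists of at most `wordsMoved / W + 1` phases
(`Executes.card_le`).

**Many multiplications.** For each `k` at least `∑ i, (m - i)` pairs `(i, j)` occur, with `i`
counted from one up to `n / 2`. This is
immediate under `CommonComponents`. Under `LinearInColumns`, column `k` of `Rbar` is a linear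
function of column `k` of the right half of `A`, whose coefficients are polynomials in the entries
of `Qtilde` used as multipliers. As the same linear function is given by the first columns of `Q`,
these columns are a polynomial function of the multipliers, and the left half of `A` is a
polynomial function of the multipliers and of the upper left block of `R`
(`left_eq_coeff_mul`). The left halves fill an open set of dimension `m * (n / 2)`, while a smooth
map into a space of larger dimension has a range without interior, so the number of multipliers
is at least `m * (n / 2)` minus the number of entries of that block
(`LinearInColumns.card_le`).
-/

namespace SeqQR

/-! ### The discrete Loomis–Whitney inequality in three dimensions -/

/-- A finite set of lattice points is controlled by its three shadows on the coordinate planes. -/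
theorem card_sq_le_of_shadows {α β γ : Type*} [DecidableEq α] [DecidableEq γ]
    (T : Finset (α × β × γ)) (X : Finset (β × α)) (Y : Finset (β × γ)) (Z : Finset (α × γ))
    (hX : ∀ p ∈ T, (p.2.1, p.1) ∈ X) (hY : ∀ p ∈ T, (p.2.1, p.2.2) ∈ Y)
    (hZ : ∀ p ∈ T, (p.1, p.2.2) ∈ Z) : T.card ^ 2 ≤ X.card * Y.card * Z.card := by
  let F : α × γ → Finset (α × β × γ) := fun z => T.filter fun p => (p.1, p.2.2) = z
  have hcard : T.card = ∑ z ∈ Z, (F z).card := Finset.card_eq_sum_card_fiberwise hZ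
  -- Two points of one fibre are determined by the shadow of the first on `X` and of the second
  -- on `Y`.
  have hpairs : ∑ z ∈ Z, (F z).card ^ 2 ≤ X.card * Y.card := by
    calc ∑ z ∈ Z, (F z).card ^ 2 = (Z.sigma fun z => F z ×ˢ F z).card := by
          rw [Finset.card_sigma]
          exact Finset.sum_congr rfl fun z _ => by rw [Finset.card_product, sq]
      _ ≤ (X ×ˢ Y).card := by
          refine Finset.card_le_card_of_injOn
            (fun u => ((u.2.1.2.1, u.2.1.1), (u.2.2.2.1, u.2.2.2.2))) ?_ ?_
          · rintro ⟨z, p, q⟩ h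
            simp only [F, Finset.mem_coe, Finset.mem_sigma, Finset.mem_product,
              Finset.mem_filter] at h ⊢
            exact ⟨hX p h.2.1.1, hY q h.2.2.1⟩
          · rintro ⟨z, ⟨p1, p2, p3⟩, q1, q2, q3⟩ h ⟨z', ⟨p1', p2', p3'⟩, q1', q2', q3'⟩ h' e
            simp only [F, Finset.mem_coe, Finset.mem_sigma, Finset.mem_product,
              Finset.mem_filter] at h h'
            obtain ⟨-, ⟨-, rfl⟩, -, hq⟩ := h
            obtain ⟨-, ⟨-, rfl⟩, -, hq'⟩ := h'
            simp only [Prod.mk.injEq] at e hq hq'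
            obtain ⟨⟨rfl, rfl⟩, rfl, rfl⟩ := e
            obtain ⟨rfl, rfl⟩ := hq
            obtain ⟨rfl, rfl⟩ := hq'
            rfl
      _ = X.card * Y.card := Finset.card_product X Y
  calc T.card ^ 2 = (∑ z ∈ Z, (F z).card) ^ 2 := by rw [hcard]
    _ ≤ Z.card * ∑ z ∈ Z, (F z).card ^ 2 := sq_sum_le_card_mul_sum_sq
    _ ≤ Z.card * (X.card * Y.card) := Nat.mul_le_mul_left _ hpairs
    _ = X.card * Y.card * Z.card := mul_comm _ _

end SeqQR

namespace SeqQR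

/-! ### The course of an execution -/

section Course

variable {V : Type}

namespace Move

/-- The words carried from slow to fast memory. -/
def loaded : Move V → Finset V
  | read S => S
  | _ => ∅

/-- The words carried from fast to slow memory. -/
def stored : Move V → Finset V
  | write S => S
  | _ => ∅

theorem card_loaded_add_card_stored (a : Move V) :
    a.loaded.card + a.stored.card = a.words := by
  cases a <;> simp [loaded, stored, words]

end Move

/-- The move number `t`, counted from zero; nothing happens after the end of the list. -/
def moveAt (l : List (Move V)) (t : ℕ) : Move V := l.getD t (.discard ∅)

/-- The number of words moved by the first `t` moves. -/
def wordsBefore (l : List (Move V)) (t : ℕ) : ℕ := ∑ u ∈ Finset.range t, (moveAt l u).words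

theorem wordsBefore_length (l : List (Move V)) : wordsBefore l l.length = wordsMoved l := by
  induction l with
  | nil => simp [wordsBefore, wordsMoved]
  | cons a l ih =>
    unfold wordsBefore wordsMoved at *
    rw [List.length_cons, Finset.sum_range_succ', List.map_cons, List.sum_cons, ← ih, add_comm]
    rfl

theorem wordsBefore_mono (l : List (Move V)) : Monotone (wordsBefore l) := fun _ _ h =>
  Finset.sum_le_sum_of_subset (Finset.range_mono h)

theorem wordsBefore_succ_of_computed {l : List (Move V)} {t : ℕ} {v : V}
    (h : (moveAt l t).computed = some v) : wordsBefore l (t + 1) = wordsBefore l t := by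
  rw [wordsBefore, Finset.sum_range_succ, ← wordsBefore]
  generalize moveAt l t = a at h
  cases a <;> simp_all [Move.computed, Move.words]

theorem computed_unique {l : List (Move V)} {v : V} [DecidableEq V]
    (h : (l.filterMap Move.computed).count v ≤ 1) {t t' : ℕ}
    (ht : (moveAt l t).computed = some v) (ht' : (moveAt l t').computed = some v) : t = t' := by
  induction l generalizing t t' with
  | nil => simp [moveAt, Move.computed] at ht
  | cons a l ih =>
    -- A second occurrence later in the list would make the count at least two.
    have key : ∀ u, (moveAt l u).computed = some v → a.computed ≠ some v := by
      intro u hu ha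
      have hmem : v ∈ l.filterMap Move.computed := by
        refine List.mem_filterMap.2 ⟨moveAt l u, ?_, hu⟩
        by_cases hul : u < l.length
        · simp [moveAt, hul]
        · simp [moveAt, Nat.le_of_not_lt hul, Move.computed] at hu
      have := List.count_pos_iff.2 hmem
      rw [List.filterMap_cons_some ha, List.count_cons_self] at h
      omega
    have hl : (l.filterMap Move.computed).count v ≤ 1 :=
      le_trans (((List.sublist_cons_self a l).filterMap _).count_le v) h
    cases t with
    | zero =>
      cases t' with
      | zero => rfl
      | succ t' => exact absurd ht (key t' ht')
    | succ t =>
      cases t' with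
      | zero => exact absurd ht' (key t ht)
      | succ t' => rw [ih hl (t := t) (t' := t') ht ht']

variable [DecidableEq V]

/-- The words that are in fast or in slow memory. -/
def State.present (s : State V) : Finset V := s.fast ∪ s.slow

/-- The state before the move number `t`. -/
def stateAt (s : State V) (l : List (Move V)) (t : ℕ) : State V := finalState s (l.take t)

theorem stateAt_length (s : State V) (l : List (Move V)) :
    stateAt s l l.length = finalState s l := by
  rw [stateAt, List.take_length]

theorem stateAt_succ (s : State V) (l : List (Move V)) (t : ℕ) :
    stateAt s l (t + 1) = (moveAt l t).next (stateAt s l t) := by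
  by_cases h : t < l.length
  · rw [stateAt, stateAt, List.take_add_one, finalState, List.foldl_append]
    simp [finalState, moveAt, h]
  · have h := Nat.le_of_not_lt h
    rw [stateAt, stateAt, List.take_of_length_le h, List.take_of_length_le (h.trans t.le_succ)]
    simp [moveAt, h, Move.next]

/-- The words read by the moves number `a`, …, `b - 1`. -/
def loadedIn (l : List (Move V)) (a b : ℕ) : Finset V :=
  (Finset.Ico a b).biUnion fun t => (moveAt l t).loaded

/-- The words written by the moves number `a`, …, `b - 1`. -/
def storedIn (l : List (Move V)) (a b : ℕ) : Finset V :=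
  (Finset.Ico a b).biUnion fun t => (moveAt l t).stored

theorem card_loadedIn_add_card_storedIn_le (l : List (Move V)) {a b : ℕ} (hab : a ≤ b) :
    (loadedIn l a b).card + (storedIn l a b).card ≤ wordsBefore l b - wordsBefore l a := by
  calc _ ≤ ∑ t ∈ Finset.Ico a b, (moveAt l t).loaded.card +
        ∑ t ∈ Finset.Ico a b, (moveAt l t).stored.card :=
        add_le_add Finset.card_biUnion_le Finset.card_biUnion_le
    _ = ∑ t ∈ Finset.Ico a b, (moveAt l t).words := by
        simp only [← Finset.sum_add_distrib, Move.card_loaded_add_card_stored]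
    _ = _ := by
        have := Finset.sum_range_add_sum_Ico (fun t => (moveAt l t).words) hab
        simp only [wordsBefore]
        omega

theorem slow_mono (s : State V) (l : List (Move V)) : Monotone fun t => (stateAt s l t).slow := by
  refine monotone_nat_of_le_succ fun t => ?_
  rw [stateAt_succ]
  cases moveAt l t <;> simp [Move.next]

theorem slow_subset (s : State V) (l : List (Move V)) {a b : ℕ} (hab : a ≤ b) :
    (stateAt s l b).slow ⊆ (stateAt s l a).slow ∪ storedIn l a b := by
  induction b, hab using Nat.le_induction with
  | base => exact Finset.subset_union_left
  | succ b hab ih =>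
    have h : storedIn l a (b + 1) = (moveAt l b).stored ∪ storedIn l a b := by
      rw [storedIn, ← Finset.insert_Ico_right_eq_Ico_add_one hab, Finset.biUnion_insert]
      rfl
    intro v hv
    have hv' : v ∈ (stateAt s l b).slow ∨ v ∈ (moveAt l b).stored := by
      rw [stateAt_succ] at hv
      generalize moveAt l b = x at hv
      cases x <;> simp_all [Move.next, Move.stored]
    rw [h]
    rcases hv' with hv' | hv'
    · have := ih hv'
      simp only [Finset.mem_union] at this ⊢
      tauto
    · simp [hv']

theorem mem_fast_succ {s : State V} {l : List (Move V)} {t : ℕ} {v : V}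
    (h : v ∈ (stateAt s l (t + 1)).fast) :
    v ∈ (stateAt s l t).fast ∨ v ∈ (moveAt l t).loaded ∨ (moveAt l t).computed = some v := by
  rw [stateAt_succ] at h
  generalize moveAt l t = x at h ⊢
  cases x with
  | compute w D =>
    simp only [Move.next, Finset.mem_insert, Finset.mem_sdiff] at h
    rcases h with rfl | h
    · exact Or.inr (Or.inr rfl)
    · exact Or.inl h.1
  | _ =>
    simp_all only [Move.next, Move.loaded, Finset.mem_union, Finset.mem_sdiff]
    tauto

theorem mem_loadedIn {l : List (Move V)} {a b t : ℕ} {v : V} (ha : a ≤ t) (hb : t < b)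
    (h : v ∈ (moveAt l t).loaded) : v ∈ loadedIn l a b :=
  Finset.mem_biUnion.2 ⟨t, Finset.mem_Ico.2 ⟨ha, hb⟩, h⟩

end Course

section Legal

variable {m n W : ℕ} {P : Program m n} {s : State P.Vertex} {l : List (Move P.Vertex)}

theorem LegalFrom.legal_moveAt (h : LegalFrom P W s l) (t : ℕ) :
    (moveAt l t).Legal P W (stateAt s l t) := by
  induction l generalizing s t with
  | nil => simp [moveAt, Move.Legal]
  | cons a l ih =>
    cases t with
    | zero => exact h.1
    | succ t => exact ih h.2 t

theorem LegalFrom.card_fast_le (h : LegalFrom P W s l) (hs : s.fast.card ≤ W) (t : ℕ) :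
    (stateAt s l t).fast.card ≤ W := by
  induction t with
  | zero => exact hs
  | succ t ih =>
    have hl := h.legal_moveAt t
    rw [stateAt_succ]
    generalize moveAt l t = x at hl ⊢
    cases x with
    | read S => exact hl.2
    | write S => exact ih
    | compute v D => exact hl.2.2
    | discard D => exact (Finset.card_le_card Finset.sdiff_subset).trans ih

theorem LegalFrom.args_mem_fast (h : LegalFrom P W s l) {t : ℕ} {v : P.Vertex}
    (ht : (moveAt l t).computed = some v) {w : P.Vertex} (hw : w ∈ (P.op v).args) :
    w ∈ (stateAt s l t).fast := by
  have hl := h.legal_moveAt t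
  generalize moveAt l t = x at hl ht
  cases x <;> simp only [Move.computed, Option.some.injEq, reduceCtorEq] at ht
  subst ht
  exact hl.2.1 w hw

theorem LegalFrom.not_isInput (h : LegalFrom P W s l) {t : ℕ} {v : P.Vertex}
    (ht : (moveAt l t).computed = some v) : ¬ (P.op v).IsInput := by
  have hl := h.legal_moveAt t
  generalize moveAt l t = x at hl ht
  cases x <;> simp only [Move.computed, Option.some.injEq, reduceCtorEq] at ht
  subst ht
  exact hl.1

theorem LegalFrom.mem_present_succ (h : LegalFrom P W s l) {t : ℕ} {v : P.Vertex}
    (hv : v ∈ (stateAt s l (t + 1)).present) :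
    v ∈ (stateAt s l t).present ∨ (moveAt l t).computed = some v := by
  have hl := h.legal_moveAt t
  rw [stateAt_succ] at hv
  generalize moveAt l t = x at hl hv ⊢
  simp only [State.present, Finset.mem_union] at hv ⊢
  cases x with
  | read S =>
    simp only [Move.next, Finset.mem_union] at hv
    have := @hl.1 v
    tauto
  | write S =>
    simp only [Move.next, Finset.mem_union] at hv
    have := @hl v
    tauto
  | compute w D =>
    simp only [Move.next, Finset.mem_insert, Finset.mem_sdiff] at hv
    simp only [Move.computed, Option.some.injEq]
    tauto
  | discard D =>
    simp only [Move.next, Finset.mem_sdiff] at hv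
    tauto

/-- A word that is absent at time `a` and present at time `b` was computed in between, and it
stayed in one of the memories from the last time at which it had been absent. -/
theorem LegalFrom.exists_computed (h : LegalFrom P W s l) {a b : ℕ} (hab : a ≤ b) {v : P.Vertex}
    (ha : v ∉ (stateAt s l a).present) (hb : v ∈ (stateAt s l b).present) :
    ∃ t, a ≤ t ∧ t < b ∧ v ∉ (stateAt s l t).present ∧ (moveAt l t).computed = some v ∧
      ∀ t', t < t' → t' ≤ b → v ∈ (stateAt s l t').present := by
  induction b, hab using Nat.le_induction with
  | base => exact absurd hb ha
  | succ b hab ih =>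
    by_cases hvb : v ∈ (stateAt s l b).present
    · obtain ⟨t, h1, h2, h3, h4, h5⟩ := ih hvb
      refine ⟨t, h1, h2.trans (Nat.lt_succ_self b), h3, h4, fun t' ht ht' => ?_⟩
      rcases Nat.lt_or_ge b t' with hlt | hge
      · rwa [show t' = b + 1 by omega]
      · exact h5 t' ht hge
    · refine ⟨b, hab, Nat.lt_succ_self b, hvb, (h.mem_present_succ hb).resolve_left hvb,
        fun t' ht ht' => ?_⟩
      rwa [show t' = b + 1 by omega]

end Legal

theorem not_mem_present_initialState {m n : ℕ} {P : Program m n} {v : P.Vertex}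
    (hv : ¬ (P.op v).IsInput) : v ∉ (initialState P).present := by
  simp [State.present, initialState, hv]

namespace ColumnwiseQR

variable {m n W : ℕ} {P : Program m n} {C : ColumnwiseQR P} {l : List (Move P.Vertex)}

/-! ### The words needed for the multiplications of a phase -/

theorem dependsOn_of_locA (C : ColumnwiseQR P) {j : Fin m} {k : Fin (n / 2)} (v : P.Vertex)
    (hv : C.locA v = some (j, k)) : P.DependsOn v (rightCol k) := by
  induction v using WellFoundedLT.induction with
  | _ v ih =>
    rcases C.A_update v j k hv with h | ⟨w, hw, hwA⟩
    · exact ⟨v, j, h, Relation.ReflTransGen.refl⟩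
    · obtain ⟨u, j', hu, hanc⟩ := ih w (P.args_lt v w hw) hwA
      exact ⟨u, j', hu, hanc.tail hw⟩

theorem locQ_eq_none_of_locA (C : ColumnwiseQR P) {v : P.Vertex} (hv : C.locA v ≠ none) :
    C.locQ v = none := by
  obtain ⟨⟨j, k⟩, hA⟩ := Option.ne_none_iff_exists'.1 hv
  by_contra hQ
  obtain ⟨p, hQ⟩ := Option.ne_none_iff_exists'.1 hQ
  have := C.columnwise_Q v p hQ _ (C.dependsOn_of_locA v hA)
  simp [rightCol] at this

/-- An entry of `Atilde` that is in use during a phase was in fast memory at the beginning of the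
phase or is read in it: the other values of that entry are updates of an earlier one. -/
theorem Executes.exists_locA (hl : C.Executes W l) {a b t : ℕ} (ha : a ≤ t) (hb : t ≤ b)
    {v : P.Vertex} {p : Fin m × Fin (n / 2)} (hvA : C.locA v = some p)
    (hv : v ∈ (stateAt (initialState P) l t).fast) :
    ∃ w ∈ (stateAt (initialState P) l a).fast ∪ loadedIn l a b, C.locA w = some p := by
  induction t, ha using Nat.le_induction generalizing v with
  | base => exact ⟨v, Finset.mem_union_left _ hv, hvA⟩
  | succ t ha ih =>
    rcases mem_fast_succ hv with h | h | h
    · exact ih (by omega) hvA h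
    · exact ⟨v, Finset.mem_union_right _ (mem_loadedIn ha hb h), hvA⟩
    · rcases C.A_update v p.1 p.2 hvA with hin | ⟨w, hw, hwA⟩
      · exact absurd ⟨_, _, hin⟩ (hl.legal.not_isInput h)
      · exact ih (by omega) hwA (hl.legal.args_mem_fast h hw)

/-- A word of `Qtilde` that is in use during a phase is in fast memory at the beginning or at the
end of the phase, or is moved in it: if it is computed in the phase, then it has to be saved,
since it may not be computed again. -/
theorem Executes.mem_of_locQ (hl : C.Executes W l) {a b t : ℕ} (ha : a ≤ t) (hb : t ≤ b)
    (hbl : b ≤ l.length) {v : P.Vertex} (hvQ : C.locQ v ≠ none)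
    (hv : v ∈ (stateAt (initialState P) l t).fast) :
    v ∈ ((stateAt (initialState P) l a).fast ∪ loadedIn l a b) ∪
      ((stateAt (initialState P) l b).fast ∪ storedIn l a b) := by
  have key : v ∈ (stateAt (initialState P) l a).fast ∪ loadedIn l a b ∨
      ∃ t₀, a ≤ t₀ ∧ t₀ < t ∧ (moveAt l t₀).computed = some v := by
    clear hbl
    induction t, ha using Nat.le_induction with
    | base => exact Or.inl (Finset.mem_union_left _ hv)
    | succ t ha ih =>
      rcases mem_fast_succ hv with h | h | h
      · rcases ih (by omega) h with h | ⟨t₀, h1, h2, h3⟩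
        · exact Or.inl h
        · exact Or.inr ⟨t₀, h1, by omega, h3⟩
      · exact Or.inl (Finset.mem_union_right _ (mem_loadedIn ha hb h))
      · exact Or.inr ⟨t, ha, by omega, h⟩
  rcases key with h | ⟨t₀, h1, h2, h3⟩
  · exact Finset.mem_union_left _ h
  refine Finset.mem_union_right _ ?_
  by_contra hnot
  simp only [Finset.mem_union, not_or] at hnot
  have hin := hl.legal.not_isInput h3
  have hinit : v ∉ (stateAt (initialState P) l 0).present := not_mem_present_initialState hin
  have hunique : ∀ {t'}, (moveAt l t').computed = some v → t' = t₀ := fun h =>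
    computed_unique (hl.Q_once v hvQ) h h3
  have habs : v ∉ (stateAt (initialState P) l t₀).present := fun hpres => by
    obtain ⟨t', -, hlt, -, hc, -⟩ := hl.legal.exists_computed (Nat.zero_le _) hinit hpres
    exact absurd (hunique hc) hlt.ne
  have hslow : v ∉ (stateAt (initialState P) l a).slow := fun h =>
    habs (Finset.mem_union_right _ (slow_mono _ _ h1 h))
  have habs' : v ∉ (stateAt (initialState P) l b).present := by
    intro hpres
    rcases Finset.mem_union.1 hpres with h | h
    · exact hnot.1 h
    · rcases Finset.mem_union.1 (slow_subset _ _ (by omega : a ≤ b) h) with h | h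
      · exact hslow h
      · exact hnot.2 h
  have hend : v ∈ (stateAt (initialState P) l l.length).present := by
    rw [stateAt_length]
    exact Finset.mem_union_right _ (hl.Q_stored v hvQ)
  obtain ⟨t', hge, -, -, hc, -⟩ := hl.legal.exists_computed hbl habs' hend
  have := hunique hc
  omega

/-- Every partial result for an entry of `Rbar` is computed at some time `t` for good: from then
on there is always a partial result for the same entry in one of the memories that was not yet in
slow memory at time `t`. The bearer of the information changes along the chain of partial results
that leads to the entry; each one is taken over at the last time at which the next one is
absent. -/
theorem Executes.exists_lasting (hl : C.Executes W l) {i k : Fin (n / 2)} (v : P.Vertex)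
    (hv : C.locR v = some (i, k)) (hin : ¬ (P.op v).IsInput) :
    ∃ t < l.length, (moveAt l t).computed = some v ∧ ∀ t', t < t' → t' ≤ l.length →
      ∃ u, C.locR u = some (i, k) ∧ u ∈ (stateAt (initialState P) l t').present ∧
        u ∉ (stateAt (initialState P) l t).slow := by
  induction v using WellFoundedGT.induction with
  | _ v ih =>
    have hinit : v ∉ (stateAt (initialState P) l 0).present := not_mem_present_initialState hin
    rcases C.R_kept v i k hv with rfl | ⟨w, hvw, hw⟩
    · have hle : leftCol i ≤ rightCol k := by
        have := i.2
        simp only [leftCol, rightCol, Fin.mk_le_mk]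
        omega
      have hend : C.R (leftCol i) (rightCol k) ∈
          (stateAt (initialState P) l l.length).present := by
        rw [stateAt_length]
        exact Finset.mem_union_right _ (hl.R_stored _ _ hle)
      obtain ⟨t, -, hlt, habs, hc, hpres⟩ :=
        hl.legal.exists_computed (Nat.zero_le _) hinit hend
      exact ⟨t, hlt, hc, fun t' h1 h2 => ⟨_, hv, hpres t' h1 h2, fun h =>
        habs (Finset.mem_union_right _ h)⟩⟩
    · have hwin : ¬ (P.op w).IsInput := by
        rintro ⟨j, c, h⟩
        simp [h, Op.args] at hvw
      obtain ⟨tw, htw, hcw, hlast⟩ := ih w (P.args_lt w v hvw) hw hwin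
      have hvfast := hl.legal.args_mem_fast hcw hvw
      obtain ⟨t, -, hlt, habs, hc, hpres⟩ := hl.legal.exists_computed (Nat.zero_le _) hinit
        (Finset.mem_union_left _ hvfast)
      refine ⟨t, hlt.trans htw, hc, fun t' h1 h2 => ?_⟩
      rcases Nat.lt_or_ge tw t' with h | h
      · obtain ⟨u, hu1, hu2, hu3⟩ := hlast t' h h2
        exact ⟨u, hu1, hu2, fun h => hu3 (slow_mono _ _ hlt.le h)⟩
      · exact ⟨v, hv, hpres t' h1 h, fun h => habs (Finset.mem_union_right _ h)⟩

/-- What is needed of a multiplication at the lattice point `x = (i, j, k)` carried out at time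
`t`: an operation is executed, fast memory holds words of `Qtilde (j, i)` and of `Atilde (j, k)`,
and from then on there is always a partial result for `Rbar (i, k)` in one of the memories that was
not yet in slow memory at time `t`. -/
def LastingAt (C : ColumnwiseQR P) (l : List (Move P.Vertex))
    (x : Fin (n / 2) × Fin m × Fin (n / 2)) (t : ℕ) : Prop :=
  (∃ v, (moveAt l t).computed = some v) ∧
  (∃ q ∈ (stateAt (initialState P) l t).fast, C.locQ q = some (x.2.1, x.1)) ∧
  (∃ a ∈ (stateAt (initialState P) l t).fast, C.locA a = some (x.2.1, x.2.2)) ∧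
  ∀ t', t < t' → t' ≤ l.length → ∃ u, C.locR u = some (x.1, x.2.2) ∧
    u ∈ (stateAt (initialState P) l t').present ∧ u ∉ (stateAt (initialState P) l t).slow

theorem Executes.exists_lastingAt (hl : C.Executes W l) (x : Fin (n / 2) × Fin m × Fin (n / 2))
    (h : C.Multiplies x.1 x.2.1 x.2.2) : ∃ t < l.length, C.LastingAt l x t := by
  obtain ⟨v, q, a, hop, hq, ha, hv⟩ := h
  have hin : ¬ (P.op v).IsInput := by
    rintro ⟨j, c, h⟩
    simp [h] at hop
  obtain ⟨t, htl, hc, hlast⟩ := hl.exists_lasting v hv hin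
  refine ⟨t, htl, ⟨v, hc⟩, ⟨q, hl.legal.args_mem_fast hc ?_, hq⟩,
    ⟨a, hl.legal.args_mem_fast hc ?_, ha⟩, hlast⟩
  · rcases hop with h | h <;> simp [h, Op.args]
  · rcases hop with h | h <;> simp [h, Op.args]

/-- A phase during which at most `W` words are moved contains at most `√(8 * W ^ 3)` lasting
multiplications. -/
theorem Executes.card_sq_le_of_phase (hl : C.Executes W l) {a b : ℕ} (hab : a ≤ b)
    (hbl : b ≤ l.length) (hW : wordsBefore l b - wordsBefore l a ≤ W)
    (T : Finset (Fin (n / 2) × Fin m × Fin (n / 2)))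
    (hT : ∀ x ∈ T, ∃ t, a ≤ t ∧ t < b ∧ C.LastingAt l x t) : T.card ^ 2 ≤ 8 * W ^ 3 := by
  classical
  have hmoved := card_loadedIn_add_card_storedIn_le l hab
  have hfast : ∀ t, (stateAt (initialState P) l t).fast.card ≤ W :=
    hl.legal.card_fast_le (by simp [initialState])
  set Fa := (stateAt (initialState P) l a).fast with hFa
  set Fb := (stateAt (initialState P) l b).fast with hFb
  set I := Fa ∪ loadedIn l a b with hI
  set O := Fb ∪ storedIn l a b with hO
  have hIcard : I.card ≤ Fa.card + (loadedIn l a b).card := Finset.card_union_le _ _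
  have hOcard : O.card ≤ Fb.card + (storedIn l a b).card := Finset.card_union_le _ _
  let XA := I.filter fun v => C.locA v ≠ none
  let XQ := I.filter fun v => C.locQ v ≠ none
  have hdisj : XA.card + XQ.card ≤ I.card := by
    rw [← Finset.card_union_of_disjoint]
    · exact Finset.card_le_card
        (Finset.union_subset (Finset.filter_subset _ _) (Finset.filter_subset _ _))
    · refine Finset.disjoint_left.2 fun v hA hQ => ?_
      exact (Finset.mem_filter.1 hQ).2 (C.locQ_eq_none_of_locA (Finset.mem_filter.1 hA).2)
  have hLW := card_sq_le_of_shadows (T.image fun x => (some x.1, some x.2.1, some x.2.2))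
    (((XQ ∪ O).image C.locQ).image fun p => (p.map Prod.fst, p.map Prod.snd))
    ((XA.image C.locA).image fun p => (p.map Prod.fst, p.map Prod.snd))
    ((O.image C.locR).image fun p => (p.map Prod.fst, p.map Prod.snd)) ?_ ?_ ?_
  rotate_left
  · intro y hy
    obtain ⟨x, hx, rfl⟩ := Finset.mem_image.1 hy
    obtain ⟨t, hat, htb, -, ⟨q, hq, hqQ⟩, -, -⟩ := hT x hx
    refine Finset.mem_image.2 ⟨_, Finset.mem_image.2 ⟨q, ?_, hqQ⟩, rfl⟩
    have hne : C.locQ q ≠ none := by simp [hqQ]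
    rcases Finset.mem_union.1 (hl.mem_of_locQ hat htb.le hbl hne hq) with h | h
    · exact Finset.mem_union_left _ (Finset.mem_filter.2 ⟨h, hne⟩)
    · exact Finset.mem_union_right _ h
  · intro y hy
    obtain ⟨x, hx, rfl⟩ := Finset.mem_image.1 hy
    obtain ⟨t, hat, htb, -, -, ⟨c, hc, hcA⟩, -⟩ := hT x hx
    obtain ⟨w, hw, hwA⟩ := hl.exists_locA hat htb.le hcA hc
    exact Finset.mem_image.2 ⟨_, Finset.mem_image.2
      ⟨w, Finset.mem_filter.2 ⟨hw, by simp [hwA]⟩, hwA⟩, rfl⟩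
  · intro y hy
    obtain ⟨x, hx, rfl⟩ := Finset.mem_image.1 hy
    obtain ⟨t, hat, htb, -, -, -, hlast⟩ := hT x hx
    obtain ⟨u, huR, hu, hus⟩ := hlast b htb hbl
    refine Finset.mem_image.2 ⟨_, Finset.mem_image.2 ⟨u, ?_, huR⟩, rfl⟩
    rcases Finset.mem_union.1 hu with h | h
    · exact Finset.mem_union_left _ h
    · rcases Finset.mem_union.1 (slow_subset _ _ hab h) with h | h
      · exact absurd (slow_mono _ _ hat h) hus
      · exact Finset.mem_union_right _ h
  have hinj : (T.image fun x => (some x.1, some x.2.1, some x.2.2)).card = T.card := by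
    refine Finset.card_image_of_injective _ ?_
    rintro ⟨_, _, _⟩ ⟨_, _, _⟩ h
    simpa using h
  rw [hinj] at hLW
  have hQ' : (((XQ ∪ O).image C.locQ).image
      fun p => (p.map Prod.fst, p.map Prod.snd)).card ≤ XQ.card + O.card :=
    (Finset.card_image_le.trans Finset.card_image_le).trans (Finset.card_union_le _ _)
  have hA' : ((XA.image C.locA).image
      fun p => (p.map Prod.fst, p.map Prod.snd)).card ≤ XA.card :=
    Finset.card_image_le.trans Finset.card_image_le
  have hR' : ((O.image C.locR).image
      fun p => (p.map Prod.fst, p.map Prod.snd)).card ≤ O.card :=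
    Finset.card_image_le.trans Finset.card_image_le
  have ha := hfast a
  have hb := hfast b
  rw [← hFa] at ha
  rw [← hFb] at hb
  -- The entries of `Qtilde` and `Atilde` together number at most `3 * W`, those of `Rbar` at
  -- most `2 * W`; hence the product of the three numbers is at most `(9 / 4) * 2 * W ^ 3`.
  have h3 : XQ.card + O.card + XA.card ≤ 3 * W := by omega
  have h2 : O.card ≤ 2 * W := by omega
  have hprod : 4 * ((XQ.card + O.card) * XA.card) ≤ 9 * W ^ 2 := by
    have := Nat.pow_le_pow_left h3 2
    zify at this ⊢
    nlinarith [sq_nonneg (((XQ.card : ℤ) + O.card) - XA.card)]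
  have hfin := hLW.trans (Nat.mul_le_mul (Nat.mul_le_mul hQ' hA') hR')
  have h4 : 4 * ((XQ.card + O.card) * XA.card) * O.card ≤ 9 * W ^ 2 * (2 * W) :=
    Nat.mul_le_mul hprod h2
  have h5 : 9 * W ^ 2 * (2 * W) = 18 * W ^ 3 := by ring
  have h6 : 4 * ((XQ.card + O.card) * XA.card) * O.card =
    4 * ((XQ.card + O.card) * XA.card * O.card) := by ring
  omega

/-- The number of lattice points at which a columnwise algorithm multiplies is bounded in terms of
the number of words moved: the execution falls into phases according to the number of words moved
so far, in units of `W`. -/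
theorem Executes.card_le (hl : C.Executes W l) (hW : 0 < W)
    (T : Finset (Fin (n / 2) × Fin m × Fin (n / 2)))
    (hT : ∀ x ∈ T, C.Multiplies x.1 x.2.1 x.2.2) :
    T.card ≤ Nat.sqrt (8 * W ^ 3) * (wordsMoved l / W + 1) := by
  classical
  have hex : ∀ x, ∃ t, x ∈ T → t < l.length ∧ C.LastingAt l x t := fun x => by
    by_cases hx : x ∈ T
    · obtain ⟨t, ht⟩ := hl.exists_lastingAt x (hT x hx)
      exact ⟨t, fun _ => ht⟩
    · exact ⟨0, fun h => absurd h hx⟩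
  choose τ hτ using hex
  have hmaps : ∀ x ∈ T, wordsBefore l (τ x) / W ∈ Finset.range (wordsMoved l / W + 1) := by
    intro x hx
    rw [Finset.mem_range, Nat.lt_succ_iff, ← wordsBefore_length]
    exact Nat.div_le_div_right (wordsBefore_mono l (hτ x hx).1.le)
  refine (Finset.card_le_mul_card_image_of_maps_to hmaps (Nat.sqrt (8 * W ^ 3)) ?_).trans_eq
    (by rw [Finset.card_range])
  intro p _
  set F := T.filter fun x => wordsBefore l (τ x) / W = p with hF
  rcases F.eq_empty_or_nonempty with h0 | hne
  · simp [h0]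
  -- The phase extends from the first to the last of its multiplications, so that a message which
  -- begins in one unit of `W` words and ends in the next is not counted.
  obtain ⟨x₁, hx₁, hmin⟩ := F.exists_min_image τ hne
  obtain ⟨x₂, hx₂, hmax⟩ := F.exists_max_image τ hne
  have h₁ := Finset.mem_filter.1 hx₁
  have h₂ := Finset.mem_filter.1 hx₂
  obtain ⟨v, hv⟩ := (hτ x₂ h₂.1).2.1
  rw [Nat.le_sqrt']
  refine hl.card_sq_le_of_phase (a := τ x₁) (b := τ x₂ + 1)
    ((hmin x₂ hx₂).trans (Nat.le_succ _)) (hτ x₂ h₂.1).1 ?_ F ?_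
  · rw [wordsBefore_succ_of_computed hv]
    have e1 := Nat.div_add_mod (wordsBefore l (τ x₁)) W
    have e2 := Nat.div_add_mod (wordsBefore l (τ x₂)) W
    have e3 := Nat.mod_lt (wordsBefore l (τ x₂)) hW
    rw [h₁.2] at e1
    rw [h₂.2] at e2
    omega
  · intro x hx
    exact ⟨τ x, hmin x hx, Nat.lt_succ_of_le (hmax x hx), (hτ x (Finset.mem_filter.1 hx).1).2⟩

end ColumnwiseQR

end SeqQR

namespace SeqQR

/-! ### Values and the columns they depend on -/

theorem Program.value_congr {m n : ℕ} (P : Program m n) {A A' : Matrix (Fin m) (Fin n) ℝ}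
    (v : P.Vertex) (h : ∀ c, P.DependsOn v c → ∀ j, A j c = A' j c) :
    P.value A v = P.value A' v := by
  induction v using WellFoundedLT.induction with
  | _ v ih =>
    have hargs : ∀ w ∈ (P.op v).args, P.value A w = P.value A' w := fun w hw =>
      ih w (P.args_lt v w hw) fun c hc => by
        obtain ⟨u, j, hu, hanc⟩ := hc
        exact h c ⟨u, j, hu, hanc.tail hw⟩
    have hin : ∀ j c, P.op v = Op.input j c → A j c = A' j c := fun j c hv =>
      h c ⟨v, j, hv, Relation.ReflTransGen.refl⟩ j
    rw [P.value_eq, P.value_eq]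
    generalize P.op v = o at hargs hin
    cases o <;> simp_all [Op.args, Op.eval]

theorem leftCol_injective {n : ℕ} : Function.Injective (leftCol (n := n)) := fun i i' h => by
  simpa [leftCol, Fin.ext_iff] using h

theorem leftCol_lt_rightCol {n : ℕ} (i k : Fin (n / 2)) : leftCol i < rightCol k := by
  have := i.2
  simp only [leftCol, rightCol, Fin.mk_lt_mk]
  omega

namespace ColumnwiseQR

variable {m n : ℕ} {P : Program m n} {C : ColumnwiseQR P}

/-! ### Algorithms that are linear in the columns of the right half -/

/-- The lattice points with last coordinate `k` at which the algorithm multiplies. -/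
abbrev Layer (C : ColumnwiseQR P) (k : Fin (n / 2)) : Type :=
  {p : Fin (n / 2) × Fin m // C.Multiplies p.1 p.2 k}

noncomputable instance (C : ColumnwiseQR P) (k : Fin (n / 2)) : Fintype (C.Layer k) :=
  Fintype.ofFinite _

/-- The word of `Qtilde` by which `Atilde (j, k)` is multiplied for `Rbar (i, k)`. -/
noncomputable def multiplier (C : ColumnwiseQR P) (k : Fin (n / 2)) (s : C.Layer k) : P.Vertex :=
  s.2.choose_spec.choose

theorem locQ_multiplier (C : ColumnwiseQR P) (k : Fin (n / 2)) (s : C.Layer k) :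
    C.locQ (C.multiplier k s) = some (s.1.2, s.1.1) :=
  s.2.choose_spec.choose_spec.choose_spec.2.1

/-- The values of the multipliers on the matrix `A`. -/
noncomputable def multiplierValues (C : ColumnwiseQR P) (k : Fin (n / 2))
    (A : Matrix (Fin m) (Fin n) ℝ) : C.Layer k → ℝ := fun s => P.value A (C.multiplier k s)

theorem multiplierValues_congr (C : ColumnwiseQR P) (k : Fin (n / 2))
    {A A' : Matrix (Fin m) (Fin n) ℝ} (h : ∀ j i, A j (leftCol i) = A' j (leftCol i)) :
    C.multiplierValues k A = C.multiplierValues k A' :=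
  funext fun s => P.value_congr _ fun c hc j =>
    h j ⟨c, C.columnwise_Q _ _ (C.locQ_multiplier k s) c hc⟩

/-- The intermediate results are linear in column `k` of the right half of the matrix, with
coefficients that are smooth (in fact polynomial) functions of the multipliers. -/
theorem LinearInColumns.exists_coeff_of_dependsOn (hC : C.LinearInColumns) (i k : Fin (n / 2))
    (v : P.Vertex) (hanc : P.Ancestor v (C.R (leftCol i) (rightCol k)))
    (hdep : P.DependsOn v (rightCol k)) :
    ∃ c : (C.Layer k → ℝ) → Fin m → ℝ, (∀ j, ContDiff ℝ 1 fun x => c x j) ∧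
      ∀ A, P.value A v = ∑ j, c (C.multiplierValues k A) j * A j (rightCol k) := by
  induction v using WellFoundedLT.induction with
  | _ v ih =>
    have hstep : ∀ w ∈ (P.op v).args, P.DependsOn w (rightCol k) →
        ∃ c : (C.Layer k → ℝ) → Fin m → ℝ, (∀ j, ContDiff ℝ 1 fun x => c x j) ∧
          ∀ A, P.value A w = ∑ j, c (C.multiplierValues k A) j * A j (rightCol k) :=
      fun w hw hd => ih w (P.args_lt v w hw) (hanc.head hw) hd
    rcases hC.linear i k v hanc hdep with ⟨j, hv⟩ | ⟨x, y, hv, hx, hy⟩ | ⟨x, y, hv, hx, hy⟩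
    · refine ⟨fun _ => Pi.single j 1, fun _ => contDiff_const, fun A => ?_⟩
      rw [P.value_eq, hv]
      simp [Op.eval, Pi.single_apply]
    · obtain ⟨c, hc, hcA⟩ := hstep x (by rcases hv with h | h <;> simp [h, Op.args]) hx
      obtain ⟨d, hd, hdA⟩ := hstep y (by rcases hv with h | h <;> simp [h, Op.args]) hy
      rcases hv with hv | hv
      · refine ⟨fun u j => c u j + d u j, fun j => (hc j).add (hd j), fun A => ?_⟩
        rw [P.value_eq, hv]
        simp [Op.eval, hcA, hdA, add_mul, Finset.sum_add_distrib]
      · refine ⟨fun u j => c u j - d u j, fun j => (hc j).sub (hd j), fun A => ?_⟩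
        rw [P.value_eq, hv]
        simp [Op.eval, hcA, hdA, sub_mul, Finset.sum_sub_distrib]
    · obtain ⟨c, hc, hcA⟩ := hstep x (by rcases hv with h | h <;> simp [h, Op.args]) hx
      have hval : ∀ A, P.value A v = P.value A y * P.value A x := fun A => by
        rw [P.value_eq]
        rcases hv with hv | hv <;> simp [hv, Op.eval, mul_comm]
      have hy' : ∃ g : (C.Layer k → ℝ) → ℝ, ContDiff ℝ 1 g ∧
          ∀ A, P.value A y = g (C.multiplierValues k A) := by
        rcases hC.multiplier k y ⟨i, v, x, hanc, hv, hx, hy⟩ with ⟨a, ha⟩ | ⟨j, i', hQ, hmul⟩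
        · exact ⟨fun _ => a, contDiff_const, fun A => by rw [P.value_eq, ha]; rfl⟩
        · let s : C.Layer k := ⟨(i', j), hmul⟩
          have hs : y = C.multiplier k s := hC.single _ _ _ hQ (C.locQ_multiplier k s)
          exact ⟨fun u => u s, contDiff_apply ℝ ℝ s, fun A => by rw [hs]; rfl⟩
      obtain ⟨g, hg, hgA⟩ := hy'
      refine ⟨fun u j => g u * c u j, fun j => hg.mul (hc j), fun A => ?_⟩
      rw [hval, hgA, hcA, Finset.mul_sum]
      exact Finset.sum_congr rfl fun j _ => (mul_assoc _ _ _).symm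

/-- The response of `Rbar` to a change in column `k` of the right half of the matrix. -/
theorem LinearInColumns.exists_coeff (hC : C.LinearInColumns) (k : Fin (n / 2)) :
    ∃ c : Fin (n / 2) → (C.Layer k → ℝ) → Fin m → ℝ,
      (∀ i j, ContDiff ℝ 1 fun x => c i x j) ∧
      ∀ i A A', (∀ j q, q ≠ rightCol k → A j q = A' j q) →
        P.value A' (C.R (leftCol i) (rightCol k)) - P.value A (C.R (leftCol i) (rightCol k)) =
          ∑ j, c i (C.multiplierValues k A) j * (A' j (rightCol k) - A j (rightCol k)) := by
  have h : ∀ i, ∃ c : (C.Layer k → ℝ) → Fin m → ℝ,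
      (∀ j, ContDiff ℝ 1 fun x => c x j) ∧
      ∀ A A', (∀ j q, q ≠ rightCol k → A j q = A' j q) →
        P.value A' (C.R (leftCol i) (rightCol k)) - P.value A (C.R (leftCol i) (rightCol k)) =
          ∑ j, c (C.multiplierValues k A) j * (A' j (rightCol k) - A j (rightCol k)) := by
    intro i
    by_cases hdep : P.DependsOn (C.R (leftCol i) (rightCol k)) (rightCol k)
    · obtain ⟨c, hc, hcA⟩ :=
        hC.exists_coeff_of_dependsOn i k _ Relation.ReflTransGen.refl hdep
      refine ⟨c, hc, fun A A' hAA' => ?_⟩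
      have hx : C.multiplierValues k A' = C.multiplierValues k A :=
        C.multiplierValues_congr k fun j i => (hAA' j _ (leftCol_lt_rightCol i k).ne).symm
      rw [hcA, hcA, hx, ← Finset.sum_sub_distrib]
      exact Finset.sum_congr rfl fun j _ => (mul_sub _ _ _).symm
    · refine ⟨fun _ _ => 0, fun _ => contDiff_const, fun A A' hAA' => ?_⟩
      rw [P.value_congr (A := A') (A' := A), sub_self]
      · simp
      · intro q hq j
        exact (hAA' j q fun h => hdep (h ▸ hq)).symm
  choose c hc hcA using h
  exact ⟨c, hc, hcA⟩

/-! ### The orthogonal factor is a function of the multipliers -/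

/-- The upper left block of the factor `R` computed for `A`. -/
noncomputable def leftR (C : ColumnwiseQR P) (A : Matrix (Fin m) (Fin n) ℝ) :
    Matrix (Fin (n / 2)) (Fin (n / 2)) ℝ :=
  Matrix.of fun i c => if i ≤ c then P.value A (C.R (leftCol i) (leftCol c)) else 0

theorem leftR_congr (C : ColumnwiseQR P) {A A' : Matrix (Fin m) (Fin n) ℝ}
    (h : ∀ j i, A j (leftCol i) = A' j (leftCol i)) : C.leftR A = C.leftR A' := by
  ext i c
  simp only [leftR, Matrix.of_apply]
  split_ifs with hic
  · refine P.value_congr _ fun q hq j => ?_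
    have hqc : (q : ℕ) ≤ c := C.columnwise_R (leftCol i) (leftCol c) hic q hq
    exact h j ⟨q, hqc.trans_lt c.2⟩
  · rfl

/-- `A = Q * R`, restricted to the left half of `A`; and `Rbar = Qbarᵀ * Abar`. -/
theorem exists_left_factor (C : ColumnwiseQR P) {A : Matrix (Fin m) (Fin n) ℝ} (hA : A ∈ C.dom) :
    ∃ Q : Matrix (Fin m) (Fin (n / 2)) ℝ, A.submatrix id leftCol = Q * C.leftR A ∧
      ∀ i k, P.value A (C.R (leftCol i) (rightCol k)) = ∑ j, Q j i * A j (rightCol k) := by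
  obtain ⟨Q, hQ, hAQ⟩ := C.correct A hA
  set R := Matrix.of fun i c => if i ≤ c then P.value A (C.R i c) else 0 with hR
  refine ⟨Q.submatrix id leftCol, ?_, fun i k => ?_⟩
  · ext j c
    have hjc : A j (leftCol c) = (Q * R) j (leftCol c) := congrFun (congrFun hAQ j) _
    rw [Matrix.submatrix_apply, id, hjc, Matrix.mul_apply, Matrix.mul_apply]
    refine (Fintype.sum_of_injective leftCol leftCol_injective _ _ (fun q hq => ?_)
      fun i => ?_).symm
    · have hlt : ¬ q ≤ leftCol c := fun h =>
        hq ⟨⟨q, lt_of_le_of_lt (Fin.le_def.1 h) c.2⟩, rfl⟩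
      simp [hR, hlt]
    · have hle : leftCol i ≤ leftCol c ↔ i ≤ c := Iff.rfl
      simp [hR, leftR, hle]
  · have hRQ : Q.transpose * A = R := by
      rw [hAQ, ← Matrix.mul_assoc, hQ, Matrix.one_mul]
    have := congrFun (congrFun hRQ (leftCol i)) (rightCol k)
    rw [Matrix.mul_apply] at this
    simp only [hR, Matrix.of_apply, (leftCol_lt_rightCol i k).le, if_true] at this
    rw [← this]
    rfl

/-- If the leading square block of the left half of `A` is regular, then the first columns of `Q`
consist of the coefficients with which `Rbar` depends on column `k` of the right half. -/
theorem left_eq_coeff_mul (C : ColumnwiseQR P) (k : Fin (n / 2))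
    {c : Fin (n / 2) → (C.Layer k → ℝ) → Fin m → ℝ}
    (hc : ∀ i A A', (∀ j q, q ≠ rightCol k → A j q = A' j q) →
      P.value A' (C.R (leftCol i) (rightCol k)) - P.value A (C.R (leftCol i) (rightCol k)) =
        ∑ j, c i (C.multiplierValues k A) j * (A' j (rightCol k) - A j (rightCol k)))
    {A : Matrix (Fin m) (Fin n) ℝ} (hA : A ∈ C.dom) (f : Fin (n / 2) → Fin m)
    (hdet : (A.submatrix f leftCol).det ≠ 0) (j : Fin m) (i : Fin (n / 2)) :
    A j (leftCol i) = ∑ q, c q (C.multiplierValues k A) j * C.leftR A q i := by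
  obtain ⟨Q, hQA, hQR⟩ := C.exists_left_factor hA
  have hfac : A.submatrix f leftCol = Q.submatrix f id * C.leftR A := by
    ext p q
    exact congrFun (congrFun hQA (f p)) q
  have hunit : IsUnit (C.leftR A).det := by
    rw [hfac, Matrix.det_mul] at hdet
    exact (right_ne_zero_of_mul hdet).isUnit
  have hQc : ∀ q, Q j q = c q (C.multiplierValues k A) j := by
    intro q
    -- Move one entry of column `k` of the right half a little, without leaving the domain.
    let B : ℝ → Matrix (Fin m) (Fin n) ℝ := fun t => A + t • Matrix.single j (rightCol k) 1
    have hB : Continuous B := by fun_prop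
    have hnhds : B ⁻¹' C.dom ∈ nhds (0 : ℝ) :=
      (C.dom_open.preimage hB).mem_nhds (by simpa [B] using hA)
    obtain ⟨t, ht, ht0⟩ :=
      ((infinite_of_mem_nhds 0 hnhds).sdiff (Set.finite_singleton (0 : ℝ))).nonempty
    have hsame : ∀ p r, r ≠ rightCol k → A p r = B t p r := fun p r hr => by
      simp [B, hr.symm]
    have hleft : ∀ p r, A p (leftCol r) = B t p (leftCol r) := fun p r =>
      hsame p _ (leftCol_lt_rightCol r k).ne
    obtain ⟨Q', hQA', hQR'⟩ := C.exists_left_factor (A := B t) ht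
    have hQQ' : Q' = Q := by
      have h : Q * C.leftR A = Q' * C.leftR A := by
        rw [← hQA, C.leftR_congr hleft, ← hQA']
        ext p r
        exact hleft p r
      have h' := congrArg (· * (C.leftR A)⁻¹) h
      simpa [Matrix.mul_assoc, Matrix.mul_nonsing_inv _ hunit] using h'.symm
    have hdiff := hc q A (B t) hsame
    rw [hQR, hQR', hQQ', ← Finset.sum_sub_distrib] at hdiff
    simp only [B, Matrix.add_apply, Matrix.smul_apply, Matrix.single_apply, smul_eq_mul,
      and_true, mul_add, add_sub_cancel_left, mul_ite, mul_one, mul_zero, Finset.sum_ite_eq,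
      Finset.mem_univ, if_true] at hdiff
    exact mul_right_cancel₀ ht0 hdiff
  have := congrFun (congrFun hQA j) i
  rw [Matrix.submatrix_apply, Matrix.mul_apply] at this
  simpa only [id, hQc] using this

/-- The domain contains matrices whose leading square block is regular. -/
theorem exists_regular (C : ColumnwiseQR P) (hmn : n ≤ m) :
    ∃ A ∈ C.dom, (A.submatrix (fun i : Fin (n / 2) => Fin.castLE hmn (leftCol i))
      leftCol).det ≠ 0 := by
  obtain ⟨A, hA⟩ := C.dom_nonempty
  let E : Matrix (Fin m) (Fin n) ℝ := Matrix.of fun j c => if j = Fin.castLE hmn c then 1 else 0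
  let B : ℝ → Matrix (Fin m) (Fin n) ℝ := fun t => A + t • E
  have hB : Continuous B := by fun_prop
  have hnhds : B ⁻¹' C.dom ∈ nhds (0 : ℝ) :=
    (C.dom_open.preimage hB).mem_nhds (by simpa [B] using hA)
  set M := A.submatrix (fun i : Fin (n / 2) => Fin.castLE hmn (leftCol i)) leftCol with hM
  -- The determinant along this line is a characteristic polynomial, with finitely many zeros.
  have hfin : {t | (-M).charpoly.IsRoot t}.Finite :=
    Polynomial.finite_setOfPred_isRoot (-M).charpoly_monic.ne_zero
  obtain ⟨t, ht, ht0⟩ := ((infinite_of_mem_nhds 0 hnhds).sdiff hfin).nonempty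
  refine ⟨B t, ht, fun h => ht0 ?_⟩
  rw [Set.mem_ofPred_eq, Polynomial.IsRoot, Matrix.eval_charpoly, ← h]
  congr 1
  ext p q
  by_cases hpq : p = q <;>
    simp [B, E, hM, Matrix.scalar_apply, leftCol_injective.eq_iff, hpq, add_comm]

/-! ### Counting parameters -/

/-- The positions on and above the diagonal of the upper left block of `R`. -/
abbrev Upper (n : ℕ) : Type := {p : Fin (n / 2) × Fin (n / 2) // p.1 ≤ p.2}

theorem card_upper (n : ℕ) : Fintype.card (Upper n) = ∑ i : Fin (n / 2), ((i : ℕ) + 1) := by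
  rw [Fintype.card_subtype, Finset.card_filter, Fintype.sum_prod_type_right]
  refine Finset.sum_congr rfl fun i _ => ?_
  rw [← Finset.card_filter, ← Fin.card_Iic]
  congr 1
  ext p
  simp

/-- The multipliers and the upper left block of `R` together determine the left half of the
matrix by a smooth map. As its range has interior points, the number of its parameters is at least
the number of entries of the left half. -/
theorem LinearInColumns.card_le (hC : C.LinearInColumns) (hmn : n ≤ m) (k : Fin (n / 2)) :
    ∑ i : Fin (n / 2), (m - ((i : ℕ) + 1)) ≤ Nat.card (C.Layer k) := by
  obtain ⟨c, hcd, hc⟩ := hC.exists_coeff k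
  let Ψ : (C.Layer k → ℝ) × (Upper n → ℝ) → (Fin m × Fin (n / 2) → ℝ) := fun u p =>
    ∑ q, c q u.1 p.1 * if h : q ≤ p.2 then u.2 ⟨(q, p.2), h⟩ else 0
  have hΨ : ContDiff ℝ 1 Ψ := by
    refine contDiff_pi.2 fun p => ContDiff.sum fun q _ => ?_
    refine ((hcd q p.1).comp contDiff_fst).mul ?_
    split_ifs with h
    · exact (contDiff_apply ℝ ℝ _).comp contDiff_snd
    · exact contDiff_const
  obtain ⟨A₀, hA₀, hdet₀⟩ := C.exists_regular hmn
  set f : Fin (n / 2) → Fin m := fun i => Fin.castLE hmn (leftCol i)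
  -- The matrix with the left half `X` and the right half of `A₀`.
  let ι : (Fin m × Fin (n / 2) → ℝ) → Matrix (Fin m) (Fin n) ℝ := fun X => Matrix.of fun j q =>
    if h : (q : ℕ) < n / 2 then X (j, ⟨q, h⟩) else A₀ j q
  have hι : Continuous ι := by
    refine continuous_matrix fun j q => ?_
    simp only [ι, Matrix.of_apply]
    split_ifs with h
    · exact continuous_apply _
    · exact continuous_const
  have hιleft : ∀ X j i, ι X j (leftCol i) = X (j, i) := fun X j i => by
    simp [ι, leftCol]
  have hopen : IsOpen {X | ι X ∈ C.dom ∧ ((ι X).submatrix f leftCol).det ≠ 0} := by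
    refine (C.dom_open.preimage hι).inter (isOpen_ne.preimage ?_ (t := {x : ℝ | x ≠ 0}))
    exact (hι.matrix_submatrix f leftCol).matrix_det
  have hne : {X | ι X ∈ C.dom ∧ ((ι X).submatrix f leftCol).det ≠ 0}.Nonempty := by
    refine ⟨fun p => A₀ p.1 (leftCol p.2), ?_⟩
    have : ι (fun p => A₀ p.1 (leftCol p.2)) = A₀ := by
      ext j q
      by_cases h : (q : ℕ) < n / 2 <;> simp [ι, h, leftCol]
    rw [Set.mem_ofPred_eq, this]
    exact ⟨hA₀, hdet₀⟩
  have hdim : Module.finrank ℝ (Fin m × Fin (n / 2) → ℝ) ≤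
      Module.finrank ℝ ((C.Layer k → ℝ) × (Upper n → ℝ)) := by
    by_contra! hlt
    obtain ⟨X, ⟨hX, hdet⟩, hnot⟩ :=
      (hΨ.dense_compl_range_of_finrank_lt_finrank hlt).inter_open_nonempty _ hopen hne
    refine hnot ⟨(C.multiplierValues k (ι X), fun p => C.leftR (ι X) p.1.1 p.1.2), ?_⟩
    ext ⟨j, i⟩
    rw [← hιleft X j i, C.left_eq_coeff_mul k hc hX f hdet j i]
    refine Finset.sum_congr rfl fun q _ => ?_
    simp only [leftR, Matrix.of_apply]
    by_cases hqi : q ≤ i <;> simp [hqi]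
  simp only [Module.finrank_prod, Module.finrank_fintype_fun_eq_card, Fintype.card_prod,
    Fintype.card_fin, card_upper] at hdim
  have hsum : ∑ i : Fin (n / 2), (m - ((i : ℕ) + 1)) + ∑ i : Fin (n / 2), ((i : ℕ) + 1) =
      m * (n / 2) := by
    have h : ∀ i : Fin (n / 2), m - ((i : ℕ) + 1) + ((i : ℕ) + 1) = m := fun i => by omega
    simp [← Finset.sum_add_distrib, h, mul_comm]
  rw [Nat.card_eq_fintype_card]
  omega

end ColumnwiseQR

end SeqQR

namespace SeqQR

/-! ### The number of multiplications and the bounds -/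

namespace ColumnwiseQR

variable {m n W : ℕ} {P : Program m n} {C : ColumnwiseQR P} {l : List (Move P.Vertex)}

theorem CommonComponents.card_le (hC : C.CommonComponents) (k : Fin (n / 2)) :
    ∑ i : Fin (n / 2), (m - ((i : ℕ) + 1)) ≤ Nat.card (C.Layer k) := by
  have h : Nat.card (C.Layer k) = ∑ i : Fin (n / 2), {j | C.Multiplies i j k}.ncard := by
    rw [Nat.card_congr ((Equiv.subtypeProdEquivSigmaSubtype
      fun i j => C.Multiplies i j k)), Nat.card_sigma]
    exact Finset.sum_congr rfl fun i _ => rfl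
  rw [h]
  exact Finset.sum_le_sum fun i _ => hC i k

theorem card_layer_le (hC : C.CommonComponents ∨ C.LinearInColumns) (hmn : n ≤ m)
    (k : Fin (n / 2)) :
    ∑ i : Fin (n / 2), (m - ((i : ℕ) + 1)) ≤ Nat.card (C.Layer k) :=
  hC.elim (fun h => h.card_le k) fun h => h.card_le hmn k

open Classical in
/-- The lattice points at which the algorithm multiplies. -/
noncomputable def latticePoints (C : ColumnwiseQR P) :
    Finset (Fin (n / 2) × Fin m × Fin (n / 2)) :=
  Finset.univ.filter fun x => C.Multiplies x.1 x.2.1 x.2.2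

theorem mem_latticePoints {x : Fin (n / 2) × Fin m × Fin (n / 2)} :
    x ∈ C.latticePoints ↔ C.Multiplies x.1 x.2.1 x.2.2 := by
  simp [latticePoints]

theorem card_latticePoints (C : ColumnwiseQR P) :
    C.latticePoints.card = ∑ k, Nat.card (C.Layer k) := by
  rw [← Nat.card_sigma, ← Nat.subtype_card C.latticePoints fun _ => mem_latticePoints]
  exact Nat.card_congr
    { toFun := fun x => ⟨x.1.2.2, (x.1.1, x.1.2.1), x.2⟩
      invFun := fun x => ⟨(x.2.1.1, x.2.1.2, x.1), x.2.2⟩ }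

/-- The number of multiplications needed for an `m × n` matrix with `n` even. -/
theorem le_card_latticePoints (hC : C.CommonComponents ∨ C.LinearInColumns) (hn : Even n)
    (hmn : n ≤ m) :
    (m : ℝ) * n ^ 2 / 4 - (n : ℝ) ^ 2 / 8 * ((n : ℝ) / 2 + 1) ≤ C.latticePoints.card := by
  obtain ⟨h, rfl⟩ := hn
  have hh : (h + h) / 2 = h := by omega
  have hsum : ∀ a : ℕ, a ≤ m → (∑ i ∈ Finset.range a, (m - (i + 1)) : ℕ) =
      (m : ℝ) * a - (a : ℝ) * (a + 1) / 2 := by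
    intro a ha
    induction a with
    | zero => simp
    | succ a ih =>
      rw [Finset.sum_range_succ, Nat.cast_add, ih (by omega), Nat.cast_sub ha]
      push_cast
      ring
  have hcard : h * ∑ i ∈ Finset.range h, (m - (i + 1)) ≤ C.latticePoints.card := by
    rw [card_latticePoints]
    calc h * ∑ i ∈ Finset.range h, (m - (i + 1))
        = ∑ _k : Fin ((h + h) / 2), ∑ i : Fin ((h + h) / 2), (m - ((i : ℕ) + 1)) := by
          rw [Fin.sum_univ_eq_sum_range (fun i => m - (i + 1)), Finset.sum_const,
            Finset.card_univ, Fintype.card_fin, hh, smul_eq_mul]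
      _ ≤ _ := Finset.sum_le_sum fun k _ => card_layer_le hC hmn k
  have hcard' : (h : ℝ) * (∑ i ∈ Finset.range h, (m - (i + 1)) : ℕ) ≤ C.latticePoints.card := by
    exact_mod_cast hcard
  rw [hsum h (by omega)] at hcard'
  refine le_trans (le_of_eq ?_) hcard'
  push_cast
  ring

/-- A message carries at most `W` words. -/
theorem Executes.wordsMoved_le (hl : C.Executes W l) : wordsMoved l ≤ messagesSent l * W := by
  have h : ∀ a ∈ l, a.words ≤ a.messages * W := by
    intro a ha
    obtain ⟨t, ht, rfl⟩ := List.getElem_of_mem ha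
    have hlegal := hl.legal.legal_moveAt t
    have hfast := hl.legal.card_fast_le (by simp [initialState]) t
    rw [show moveAt l t = l[t] by simp [moveAt, ht]] at hlegal
    generalize l[t] = x at hlegal
    cases x with
    | read S =>
      simpa [Move.words, Move.messages] using
        (Finset.card_le_card Finset.subset_union_right).trans hlegal.2
    | write S =>
      simpa [Move.words, Move.messages] using (Finset.card_le_card hlegal).trans hfast
    | compute v D => simp [Move.words]
    | discard D => simp [Move.words]
  unfold wordsMoved messagesSent
  rw [← List.sum_map_mul_right]
  exact List.sum_le_sum h

end ColumnwiseQR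

end SeqQR

open SeqQR in
theorem mainTheorem2 (m n W : ℕ) (hn : Even n) (hmn : n ≤ m) (hW : 0 < W)
    (P : Program m n) (C : ColumnwiseQR P) (hC : C.CommonComponents ∨ C.LinearInColumns)
    (l : List (Move P.Vertex)) (hl : C.Executes W l) :
    ((wordsMoved l : ℝ) ≥
        ((m : ℝ) * n ^ 2 / 4 - (n : ℝ) ^ 2 / 8 * ((n : ℝ) / 2 + 1)) / √(8 * (W : ℝ)) - W ∧
      ((m : ℝ) * n ^ 2 / 4 - (n : ℝ) ^ 2 / 8 * ((n : ℝ) / 2 + 1)) / √(8 * (W : ℝ)) - W ≥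
        3 * (n : ℝ) ^ 2 * ((m : ℝ) - 4 / 3) / (16 * √(8 * (W : ℝ))) - W) ∧
    ((messagesSent l : ℝ) ≥
        ((m : ℝ) * n ^ 2 / 4 - (n : ℝ) ^ 2 / 8 * ((n : ℝ) / 2 + 1)) / √(8 * (W : ℝ) ^ 3) - 1 ∧
      ((m : ℝ) * n ^ 2 / 4 - (n : ℝ) ^ 2 / 8 * ((n : ℝ) / 2 + 1)) / √(8 * (W : ℝ) ^ 3) - 1 ≥
        3 * (n : ℝ) ^ 2 * ((m : ℝ) - 4 / 3) / (16 * √(8 * (W : ℝ) ^ 3)) - 1) := by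
  have hcount := hl.card_le hW C.latticePoints fun _ =>
    ColumnwiseQR.mem_latticePoints.1
  have hpoints := ColumnwiseQR.le_card_latticePoints hC hn hmn
  have hmessages := hl.wordsMoved_le
  have hW' : (0 : ℝ) < W := Nat.cast_pos.2 hW
  have hmn' : (n : ℝ) ≤ m := Nat.cast_le.2 hmn
  have hroot : √(8 * (W : ℝ) ^ 3) = W * √(8 * (W : ℝ)) := by
    rw [show 8 * (W : ℝ) ^ 3 = (W : ℝ) ^ 2 * (8 * W) by ring, Real.sqrt_mul (sq_nonneg _),
      Real.sqrt_sq hW'.le]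
  have hpos : 0 < √(8 * (W : ℝ)) := Real.sqrt_pos.2 (by positivity)
  have hpos' : 0 < √(8 * (W : ℝ) ^ 3) := Real.sqrt_pos.2 (by positivity)
  have hsqrt : (Nat.sqrt (8 * W ^ 3) : ℝ) ≤ √(8 * (W : ℝ) ^ 3) := by
    exact_mod_cast Real.nat_sqrt_le_real_sqrt (a := 8 * W ^ 3)
  set N : ℝ := (m : ℝ) * n ^ 2 / 4 - (n : ℝ) ^ 2 / 8 * ((n : ℝ) / 2 + 1) with hN
  have hN' : 3 * (n : ℝ) ^ 2 * ((m : ℝ) - 4 / 3) / 16 ≤ N := by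
    have := mul_nonneg (sq_nonneg (n : ℝ)) (sub_nonneg.2 hmn')
    have := sq_nonneg (n : ℝ)
    rw [hN]
    nlinarith
  have hphases : N ≤ √(8 * (W : ℝ) ^ 3) * ((wordsMoved l / W : ℕ) + 1) := by
    refine hpoints.trans (le_trans (b := (Nat.sqrt (8 * W ^ 3) : ℝ) *
      ((wordsMoved l / W : ℕ) + 1)) (by exact_mod_cast hcount) ?_)
    gcongr
  have hsecond : ∀ r : ℝ, 0 < r →
      3 * (n : ℝ) ^ 2 * ((m : ℝ) - 4 / 3) / (16 * r) ≤ N / r := fun r hr => by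
    rw [← div_div]
    gcongr
  refine ⟨⟨?_, sub_le_sub_right (hsecond _ hpos) _⟩,
    ⟨?_, sub_le_sub_right (hsecond _ hpos') _⟩⟩
  · have hdiv : ((wordsMoved l / W : ℕ) : ℝ) * W ≤ wordsMoved l := by
      exact_mod_cast Nat.div_mul_le_self _ _
    rw [ge_iff_le, sub_le_iff_le_add, div_le_iff₀ hpos]
    calc N ≤ √(8 * (W : ℝ) ^ 3) * ((wordsMoved l / W : ℕ) + 1) := hphases
      _ = (((wordsMoved l / W : ℕ) : ℝ) * W + W) * √(8 * (W : ℝ)) := by rw [hroot]; ring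
      _ ≤ _ := by gcongr
  · have hdiv : ((wordsMoved l / W : ℕ) : ℝ) ≤ messagesSent l := by
      exact_mod_cast Nat.div_le_of_le_mul (by rwa [mul_comm])
    rw [ge_iff_le, sub_le_iff_le_add, div_le_iff₀ hpos']
    calc N ≤ √(8 * (W : ℝ) ^ 3) * ((wordsMoved l / W : ℕ) + 1) := hphases
      _ ≤ √(8 * (W : ℝ) ^ 3) * (messagesSent l + 1) := by gcongr
      _ = _ := mul_comm _ _
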